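/- Let $M=(V,E,F)$ be a connected map, that is, a finite connected graph $(V,E)$ (loops and multiple edges allowed) embedded in a closed connected oriented surface so that every face is an open disc. The map is given by its rotation system: the set of half-edges (two for each edge), the involution exchanging the two ends of each edge, and, for each vertex $v$, the anticlockwise cyclic order $\pi_v$ of the half-edges at $v$. The faces $F$ are the orbits of half-edges under the face-tracing rule "move to the other end of the edge, then take the previous half-edge in the anticlockwise order at that vertex"; a map consisting of one vertex and no edges has exactly one face. Let $\chi(M)=|V|-|E|+|F|$. Fix an arbitrary orientation of the edges, and let $G$ be a finite group. A local $G$-flow of $M$ is a function $\varphi:E\to G$ (the identity being allowed as a value) such that, for each vertex $v$, the product of the values of $\varphi$ on the half-edges at $v$, taken in anticlockwise cyclic order and with values on incoming edges inverted, equals the identity of $G$ (the starting half-edge is immaterial). Let $q^1_G(M)$ be the number of local $G$-flows of $M$. Then $G$ has only finitely many irreducible complex representations up to isomorphism and, writing $n_\ell$ for their dimensions (one index $\ell$ for each isomorphism class), $$q^1_G(M)=|G|^{|E|-|V|}\sum_{\ell} n_\ell^{\chi(M)}.$$ -/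

import Mathlib

/-- A map, i.e. a graph cellularly embedded in closed oriented surfaces (one surface for each
connected component of the graph), given as a graph with a rotation system.

`V` and `E` are the sets of vertices and edges of the underlying graph (loops and multiple edges
are allowed), and `H` is the set of half-edges (edge-ends). Each edge consists of exactly two
half-edges, interchanged by `opp`. The rotation `rot` sends a half-edge at a vertex `v` to the
next half-edge at `v` in the anticlockwise order, so its cycles are exactly the sets of
half-edges at the non-isolated vertices. -/
structure OrientedMap (V E H : Type*) where
  /-- the vertex at which a half-edge is attached -/
  vertex : H → V
  /-- the edge of which a half-edge is an end -/
  edge : H → E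
  /-- the other end of the same edge -/
  opp : Equiv.Perm H
  /-- the next half-edge at the same vertex in the anticlockwise order -/
  rot : Equiv.Perm H
  edge_surjective : Function.Surjective edge
  opp_ne : ∀ h, opp h ≠ h
  edge_eq_iff : ∀ h k, edge h = edge k ↔ k = h ∨ k = opp h
  vertex_eq_iff : ∀ h k, vertex h = vertex k ↔ rot.SameCycle h k

namespace OrientedMap

variable {V E H : Type*} (M : OrientedMap V E H)

/-- Adjacency of distinct vertices in the underlying graph. It determines the connected
components, loops and edge multiplicities being irrelevant for these. -/
def underlying : SimpleGraph V :=
  SimpleGraph.fromRel fun u v => ∃ h, M.vertex h = u ∧ M.vertex (M.opp h) = v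

/-- A map is connected if its underlying graph is (in particular there is at least one vertex). -/
def Connected : Prop := M.underlying.Connected

/-- One step of face tracing, for a half-edge `h` regarded as its edge being left from the vertex
of `h`: move to the other end of the edge, and there select the previous half-edge in the
anticlockwise order. -/
def faceNext : Equiv.Perm H := M.opp.trans M.rot.symm

/-- The faces of a map: the cycles of the face tracing permutation and, for each isolated vertex
(which is a component embedded in its own sphere), the one face around that vertex. -/
def Face : Type _ :=
  Quotient (Equiv.Perm.SameCycle.setoid M.faceNext) ⊕ {v : V // ∀ h, M.vertex h ≠ v}

/-- The Euler characteristic `|V| - |E| + |F|`. -/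
noncomputable def eulerChar : ℤ := (Nat.card V : ℤ) - Nat.card E + Nat.card M.Face

/-- The degree of the vertex at which `h` is attached (a loop is counted twice). -/
noncomputable def degreeAt (h : H) : ℕ := Nat.card {k : H // M.vertex k = M.vertex h}

/-- An orientation of the edges: a choice, for each edge, of the half-edge at its tail. -/
structure Orientation where
  tail : E → H
  edge_tail : ∀ e, M.edge (tail e) = e

variable {M} {G : Type*} [Group G]

open Classical in
/-- The factor that the half-edge `h` contributes to the product around its vertex: the value on
its edge if the edge is outgoing at `h`, the inverse of that value if it is incoming at `h`. -/
noncomputable def Orientation.value (o : M.Orientation) (φ : E → G) (h : H) : G :=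
  if h = o.tail (M.edge h) then φ (M.edge h) else (φ (M.edge h))⁻¹

/-- `φ : E → G` is a local `G`-flow if at each vertex the product of the values around it in
anticlockwise order, those on incoming edges being inverted, is the identity. The product is
required to be the identity from every half-edge `h` at which one can start; at an isolated
vertex the product is empty and there is no condition. -/
def Orientation.IsLocalFlow (o : M.Orientation) (φ : E → G) : Prop :=
  ∀ h, ((List.range (M.degreeAt h)).map fun i => o.value φ ((M.rot ^ i) h)).prod = 1

variable (G) in
/-- The number of local `G`-flows (the identity being allowed as a value). -/
noncomputable def Orientation.numLocalFlows (o : M.Orientation) : ℕ :=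
  Nat.card {φ : E → G // o.IsLocalFlow φ}

end OrientedMap

/-- The irreducible representations of `G` on the spaces `ℂⁿ`. -/
def Irrep (G : Type*) [Group G] : Type _ :=
  Σ n : ℕ, {ρ : Representation ℂ G (Fin n → ℂ) // ρ.IsIrreducible}

/-- Isomorphism of representations. -/
instance Irrep.setoid (G : Type*) [Group G] : Setoid (Irrep G) where
  r ρ σ := Nonempty (ρ.2.1.Equiv σ.2.1)
  iseqv := ⟨fun _ => ⟨.refl _⟩, fun ⟨e⟩ => ⟨e.symm⟩, fun ⟨e⟩ ⟨f⟩ => ⟨e.trans f⟩⟩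

/-- The isomorphism classes of irreducible finite-dimensional complex representations of `G`
(every finite-dimensional complex representation is isomorphic to one on some `ℂⁿ`). -/
def IrrepClass (G : Type*) [Group G] : Type _ := Quotient (Irrep.setoid G)

/-- The dimension of an isomorphism class of irreducible representations. -/
def IrrepClass.dim {G : Type*} [Group G] : IrrepClass G → ℕ :=
  Quotient.lift (fun ρ : Irrep G => ρ.1) fun ρ σ ⟨e⟩ => by
    simpa using LinearEquiv.finrank_eq e.toLinearEquiv

/-! A flow count is turned into a state sum and evaluated in two orders. By Wedderburn, `ℂ[G]` is a
product of matrix blocks of sizes `d k`, and the character of the regular representation, `∑ k, d k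
* tr (ρ_k g)`, is `|G|` at `g = 1` and `0` elsewhere. The product over the vertices of this
character at the vertex products, summed over all `φ`, is therefore `|G|^|V|` times the number of
flows.

Expanding each trace places a matrix index on every corner, recorded at the half-edge following it
(`prod_sum_mul_rotProd_diag`). Each edge variable then occurs in just two matrix entries, at `g` and
`g⁻¹`, so Schur orthogonality sums it out (`sum_prod_wedderburnMatrix`): the edge contributes `|G| /
d k` and identifies the indices of corners adjacent along a face. Connectedness leaves one block and
one free index per face, whence `∑ k, (d k)^|V| (|G| / d k)^|E| (d k)^|F|`. The blocks are exactly
the irreducible representations (`blockClass_injective`, `blockClass_surjective`). The one-vertex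
map without edges is separate, and reduces to `∑ k, (d k)^2 = |G|`. -/

/-! ### Schur orthogonality and the regular character -/

section WedderburnBlocks

open Matrix

variable {G ι : Type*} [Group G] {d : ι → ℕ}
  (e : MonoidAlgebra ℂ G ≃ₐ[ℂ] Π k, Matrix (Fin (d k)) (Fin (d k)) ℂ)

/-- The matrix of a group element in a block of a Wedderburn decomposition. -/
noncomputable def blockMatrix (k : ι) : G →* Matrix (Fin (d k)) (Fin (d k)) ℂ :=
  ((Pi.evalMonoidHom (fun k => Matrix (Fin (d k)) (Fin (d k)) ℂ) k).comp
    (MonoidHomClass.toMonoidHom e)).comp (MonoidAlgebra.of ℂ G)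

theorem blockMatrix_apply (k : ι) (g : G) :
    blockMatrix e k g = e (MonoidAlgebra.of ℂ G g) k := rfl

/-- Averaging over `G` produces an intertwiner: for a group element `h`, substitute `h * g` for `g`;
then extend linearly. -/
theorem sum_blockMatrix_conj_mul [Fintype G] {k l : ι}
    (X : Matrix (Fin (d k)) (Fin (d l)) ℂ) (a : MonoidAlgebra ℂ G) :
    e a k * ∑ g, blockMatrix e k g * X * blockMatrix e l g⁻¹ =
      (∑ g, blockMatrix e k g * X * blockMatrix e l g⁻¹) * e a l := by
  induction a using MonoidAlgebra.induction_on with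
  | of h =>
    rw [← blockMatrix_apply, ← blockMatrix_apply, Matrix.mul_sum, Matrix.sum_mul]
    refine Fintype.sum_equiv (Equiv.mulLeft h) _ _ fun g => ?_
    simp only [Equiv.coe_mulLeft, _root_.mul_inv_rev, map_mul, Matrix.mul_assoc]
    rw [← map_mul (blockMatrix e l) h⁻¹ h]
    simp
  | add a b ha hb => simp only [map_add, Pi.add_apply, Matrix.add_mul, Matrix.mul_add, ha, hb]
  | smul c a ha => simp only [map_smul, Pi.smul_apply, Matrix.smul_mul, Matrix.mul_smul, ha]

variable [DecidableEq ι]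

theorem sum_blockMatrix_conj_of_ne [Fintype G] {k l : ι} (hkl : k ≠ l)
    (X : Matrix (Fin (d k)) (Fin (d l)) ℂ) :
    ∑ g, blockMatrix e k g * X * blockMatrix e l g⁻¹ = 0 := by
  simpa [hkl.symm] using sum_blockMatrix_conj_mul e X (e.symm (Pi.single k 1))

/-- The average commutes with the full matrix block, hence is scalar; its trace determines the
scalar. -/
theorem sum_blockMatrix_conj_self [Fintype G] (k : ι)
    (X : Matrix (Fin (d k)) (Fin (d k)) ℂ) :
    ∑ g, blockMatrix e k g * X * blockMatrix e k g⁻¹ =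
      ((Nat.card G : ℂ) / d k * X.trace) • 1 := by
  set Y := ∑ g, blockMatrix e k g * X * blockMatrix e k g⁻¹ with hY
  have hc (A : Matrix (Fin (d k)) (Fin (d k)) ℂ) : A * Y = Y * A := by
    simpa using sum_blockMatrix_conj_mul e X (e.symm (Pi.single k A))
  obtain ⟨c, hc⟩ := mem_range_scalar_of_commute_single (M := Y) fun i j _ => hc _
  have ht : Y.trace = Nat.card G * X.trace := by
    have h (g : G) : (blockMatrix e k g * X * blockMatrix e k g⁻¹).trace = X.trace := by
      rw [Matrix.trace_mul_comm, ← Matrix.mul_assoc, ← map_mul]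
      simp
    simp [hY, Matrix.trace_sum, h]
  rcases Nat.eq_zero_or_pos (d k) with h0 | h0
  · ext i
    exact absurd i.2 (by omega)
  · have h0 : (d k : ℂ) ≠ 0 := by exact_mod_cast h0.ne'
    rw [← hc] at ht ⊢
    simp only [scalar_apply, trace_diagonal, Finset.sum_const, Finset.card_univ,
      Fintype.card_fin, nsmul_eq_mul] at ht
    rw [div_mul_eq_mul_div, ← ht, mul_div_cancel_left₀ _ h0]
    simp [smul_one_eq_diagonal]

variable [Fintype ι]

/-- The block diagonal matrix representation obtained from a Wedderburn decomposition. -/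
noncomputable def wedderburnMatrix : G →* Matrix (Σ k, Fin (d k)) (Σ k, Fin (d k)) ℂ where
  toFun g := blockDiagonal' fun k => blockMatrix e k g
  map_one' := by
    simp only [map_one]
    exact blockDiagonal'_one
  map_mul' g h := by
    simp only [map_mul]
    exact blockDiagonal'_mul _ _

theorem wedderburnMatrix_mk (g : G) (k : ι) (i j : Fin (d k)) :
    wedderburnMatrix e g ⟨k, i⟩ ⟨k, j⟩ = blockMatrix e k g i j :=
  blockDiagonal'_apply_eq _ _ _ _

theorem wedderburnMatrix_of_ne (g : G) {a b : Σ k, Fin (d k)} (h : a.1 ≠ b.1) :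
    wedderburnMatrix e g a b = 0 :=
  blockDiagonal'_apply_ne _ _ _ h

/-- The Schur orthogonality relations. -/
theorem sum_wedderburnMatrix_mul_inv [Fintype G] (a b c f : Σ k, Fin (d k)) :
    ∑ g, wedderburnMatrix e g a b * wedderburnMatrix e g⁻¹ c f =
      if a = f ∧ b = c ∧ a.1 = b.1 then (Nat.card G : ℂ) / d a.1 else 0 := by
  obtain ⟨k, i⟩ := a
  obtain ⟨k', j⟩ := b
  obtain ⟨l, m⟩ := c
  obtain ⟨l', n⟩ := f
  by_cases hk : k = k'
  swap
  · simp [wedderburnMatrix_of_ne e _ (a := ⟨k, i⟩) (b := ⟨k', j⟩) hk, hk]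
  by_cases hl : l = l'
  swap
  · simp only [wedderburnMatrix_of_ne e _ (a := ⟨l, m⟩) (b := ⟨l', n⟩) hl, mul_zero,
      Finset.sum_const_zero]
    rw [if_neg]
    rintro ⟨h1, h2, h3⟩
    simp only [Sigma.mk.injEq] at h1 h2
    exact hl (h2.1.symm.trans (hk.symm.trans h1.1))
  subst hk hl
  simp only [wedderburnMatrix_mk]
  -- Inserting a matrix unit makes the product of two entries a single entry of an averaged matrix.
  have hs (g : G) : blockMatrix e k g i j * blockMatrix e l g⁻¹ m n =
      (blockMatrix e k g * Matrix.single j m (1 : ℂ) * blockMatrix e l g⁻¹) i n := by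
    rw [Matrix.mul_apply, Finset.sum_eq_single m]
    · simp
    · intro b _ hb
      simp [hb]
    · simp
  simp only [hs, ← Matrix.sum_apply]
  by_cases hkl : k = l
  · subst hkl
    rw [sum_blockMatrix_conj_self]
    by_cases h1 : i = n <;> by_cases h2 : j = m <;>
      simp [h1, h2, Matrix.trace_single_eq_of_ne]
  · rw [sum_blockMatrix_conj_of_ne e hkl]
    simp [hkl]

/-- A block acts on itself as `d k` copies of its column space, one for each column. -/
theorem trace_mulLeft_pi_matrix (x : Π k, Matrix (Fin (d k)) (Fin (d k)) ℂ) :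
    LinearMap.trace ℂ _ (LinearMap.mulLeft ℂ x) = ∑ k, (d k : ℂ) * (x k).trace := by
  rw [LinearMap.trace_eq_matrix_trace ℂ
    (Pi.basis fun k => Matrix.stdBasis ℂ (Fin (d k)) (Fin (d k)))]
  simp only [Matrix.trace, Matrix.diag, LinearMap.toMatrix_apply, Fintype.sum_sigma,
    Fintype.sum_prod_type, Pi.basis_apply, Pi.basis_repr, LinearMap.mulLeft_apply, Pi.mul_apply,
    Pi.single_eq_same]
  refine Finset.sum_congr rfl fun k _ => ?_
  rw [Finset.mul_sum]
  refine Finset.sum_congr rfl fun i _ => ?_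
  have (j : Fin (d k)) : ((stdBasis ℂ (Fin (d k)) (Fin (d k))).repr
      (x k * stdBasis ℂ (Fin (d k)) (Fin (d k)) (i, j))) (i, j) = x k i i := by
    have hr (A : Matrix (Fin (d k)) (Fin (d k)) ℂ) :
        ((stdBasis ℂ (Fin (d k)) (Fin (d k))).repr A) (i, j) = A i j := by
      simp [Matrix.stdBasis]
    rw [hr, stdBasis_eq_single]
    simp
  simp [this]

/-- The character of the regular representation. -/
theorem sum_mul_trace_blockMatrix [Finite G] [DecidableEq G] (g : G) :
    ∑ k, (d k : ℂ) * (blockMatrix e k g).trace = if g = 1 then (Nat.card G : ℂ) else 0 := by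
  have := Fintype.ofFinite G
  simp only [blockMatrix_apply]
  rw [← trace_mulLeft_pi_matrix]
  -- Transported to `ℂ[G]`, the trace counts the `h` with `g * h = h`.
  have hconj : LinearMap.mulLeft ℂ (e (MonoidAlgebra.of ℂ G g)) =
      e.toLinearEquiv.conj (LinearMap.mulLeft ℂ (MonoidAlgebra.of ℂ G g)) := by
    refine LinearMap.ext fun x => ?_
    simp [LinearEquiv.conj_apply]
  rw [hconj, LinearMap.trace_conj', LinearMap.trace_eq_matrix_trace ℂ (MonoidAlgebra.basis G ℂ)]
  have (h : G) : LinearMap.toMatrix (MonoidAlgebra.basis G ℂ) (MonoidAlgebra.basis G ℂ)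
      (LinearMap.mulLeft ℂ (MonoidAlgebra.of ℂ G g)) h h = if g = 1 then 1 else 0 := by
    rw [LinearMap.toMatrix_apply]
    simp [MonoidAlgebra.basis, Finsupp.single_apply]
  simp only [Matrix.trace, Matrix.diag, this]
  simp

theorem sum_dim_mul_wedderburnMatrix [Finite G] [DecidableEq G] (g : G) :
    ∑ a : Σ k, Fin (d k), (d a.1 : ℂ) * wedderburnMatrix e g a a =
      if g = 1 then (Nat.card G : ℂ) else 0 := by
  rw [← sum_mul_trace_blockMatrix e g, Fintype.sum_sigma]
  simp only [wedderburnMatrix_mk, Matrix.trace, Matrix.diag, Finset.mul_sum]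

end WedderburnBlocks

/-! ### Blocks as the irreducible representations -/

section BlockIrreps

open Matrix

variable {G ι : Type*} [Group G] {d : ι → ℕ}
  (e : MonoidAlgebra ℂ G ≃ₐ[ℂ] Π k, Matrix (Fin (d k)) (Fin (d k)) ℂ)

/-- The representation of the group on a block of a Wedderburn decomposition. -/
noncomputable def blockRep (k : ι) : Representation ℂ G (Fin (d k) → ℂ) :=
  (MonoidHomClass.toMonoidHom (Matrix.toLinAlgEquiv' (R := ℂ) (n := Fin (d k)))).comp
    (blockMatrix e k)

theorem blockRep_apply (k : ι) (g : G) (v : Fin (d k) → ℂ) :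
    blockRep e k g v = blockMatrix e k g *ᵥ v := by
  simp [blockRep]

theorem asAlgebraHom_blockRep (k : ι) (a : MonoidAlgebra ℂ G) (v : Fin (d k) → ℂ) :
    (blockRep e k).asAlgebraHom a v = e a k *ᵥ v := by
  induction a using MonoidAlgebra.induction_on with
  | of h => rw [Representation.asAlgebraHom_of, blockRep_apply, blockMatrix_apply]
  | add a b ha hb => simp [ha, hb, Matrix.add_mulVec]
  | smul c a ha => simp [ha, Matrix.smul_mulVec]

theorem Subrepresentation.asAlgebraHom_mem {W : Type*} [AddCommGroup W] [Module ℂ W]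
    {ρ : Representation ℂ G W} (S : Subrepresentation ρ) (a : MonoidAlgebra ℂ G) {w : W}
    (hw : w ∈ S.toSubmodule) : ρ.asAlgebraHom a w ∈ S.toSubmodule := by
  induction a using MonoidAlgebra.induction_on with
  | of h =>
    rw [Representation.asAlgebraHom_of]
    exact S.apply_mem_toSubmodule h hw
  | add a b ha hb => simpa using S.toSubmodule.add_mem ha hb
  | smul c a ha => simpa using S.toSubmodule.smul_mem c ha

theorem Representation.IntertwiningMap.map_asAlgebraHom {W W' : Type*}
    [AddCommGroup W] [Module ℂ W] [AddCommGroup W'] [Module ℂ W']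
    {ρ : Representation ℂ G W} {σ : Representation ℂ G W'} (f : IntertwiningMap ρ σ)
    (a : MonoidAlgebra ℂ G) (w : W) : f (ρ.asAlgebraHom a w) = σ.asAlgebraHom a (f w) := by
  induction a using MonoidAlgebra.induction_on with
  | of h => simpa using f.isIntertwining _ _ h w
  | add a b ha hb => simp [ha, hb]
  | smul c a ha => simp [ha]

variable [DecidableEq ι]

theorem isIrreducible_blockRep (k : ι) (hk : d k ≠ 0) : (blockRep e k).IsIrreducible := by
  have : Nonempty (Fin (d k)) := ⟨⟨0, by omega⟩⟩
  have hbt : (⊥ : Subrepresentation (blockRep e k)) ≠ ⊤ := fun h => by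
    have h1 : (1 : Fin (d k) → ℂ) ∈ (⊤ : Subrepresentation (blockRep e k)).toSubmodule :=
      Submodule.mem_top
    rw [← h] at h1
    exact one_ne_zero ((Submodule.mem_bot ℂ).1 h1)
  refine { exists_pair_ne := ⟨_, _, hbt⟩, eq_bot_or_eq_top := fun S => ?_ }
  by_cases hS : S.toSubmodule = ⊥
  · exact .inl (Subrepresentation.toSubmodule_injective hS)
  · refine .inr (Subrepresentation.toSubmodule_injective ?_)
    obtain ⟨v, hv, hv0⟩ := Submodule.exists_mem_ne_zero_of_ne_bot hS
    obtain ⟨j, hj⟩ := Function.ne_iff.1 hv0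
    refine (Submodule.eq_top_iff'.2 fun w => ?_)
    -- Since `v j ≠ 0`, this rank-one matrix sends `v` to the arbitrary vector `w`.
    have h := Subrepresentation.asAlgebraHom_mem S
      (e.symm (Pi.single k (vecMulVec w (Pi.single j (v j)⁻¹)))) hv
    rw [asAlgebraHom_blockRep] at h
    have hw : vecMulVec w (Pi.single j (v j)⁻¹) *ᵥ v = w := by
      rw [vecMulVec_mulVec]
      simp [inv_mul_cancel₀ hj]
    simpa [hw] using h

/-- The isomorphism class of the representation on a block. -/
noncomputable def blockClass (hd : ∀ k, d k ≠ 0) (k : ι) : IrrepClass G :=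
  Quotient.mk _ ⟨d k, blockRep e k, isIrreducible_blockRep e k (hd k)⟩

/-- The central idempotent of block `k` acts as the identity on that block and as zero on any other.
-/
theorem blockClass_injective (hd : ∀ k, d k ≠ 0) : Function.Injective (blockClass e hd) := by
  intro k l h
  by_contra hkl
  obtain ⟨f⟩ := Quotient.exact h
  have : Nonempty (Fin (d k)) := ⟨⟨0, Nat.pos_of_ne_zero (hd k)⟩⟩
  have h1 := f.toIntertwiningMap.map_asAlgebraHom (e.symm (Pi.single k 1)) (1 : Fin (d k) → ℂ)
  simp only [asAlgebraHom_blockRep] at h1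
  simp [Pi.single_eq_of_ne (Ne.symm hkl)] at h1

/-- Writing `1` as a sum of diagonal matrix units, some unit does not kill a given nonzero vector
`v`. Letting the matrices supported in that unit's column act on `v` gives a nonzero intertwiner
from the block, an isomorphism by Schur's lemma. -/
theorem blockClass_surjective [Fintype ι] (hd : ∀ k, d k ≠ 0) :
    Function.Surjective (blockClass e hd) := by
  intro c
  obtain ⟨⟨n, ρ, hρ⟩, rfl⟩ := Quotient.exists_rep c
  obtain ⟨S, hS⟩ := exists_ne (⊥ : Subrepresentation ρ)
  obtain ⟨v, -, hv⟩ := Submodule.exists_mem_ne_zero_of_ne_bot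
    (fun h => hS (Subrepresentation.toSubmodule_injective h) : S.toSubmodule ≠ ⊥)
  have hone : (1 : MonoidAlgebra ℂ G) =
      ∑ k, ∑ i, e.symm (Pi.single k (Matrix.single i i (1 : ℂ))) := by
    apply e.injective
    simp only [map_one, map_sum, AlgEquiv.apply_symm_apply]
    funext k
    rw [Finset.sum_apply, Finset.sum_eq_single k]
    · simp only [Finset.sum_apply, Pi.single_eq_same, Pi.one_apply]
      ext a b
      simp [Matrix.sum_apply, Matrix.one_apply, Matrix.single_apply, ite_and]
    · intro l _ hl
      simp [Finset.sum_apply, Pi.single_eq_of_ne hl.symm]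
    · simp
  obtain ⟨k, i, hki⟩ :
      ∃ k i, ρ.asAlgebraHom (e.symm (Pi.single k (Matrix.single i i (1 : ℂ)))) v ≠ 0 := by
    by_contra! h
    apply hv
    have h1 : ρ.asAlgebraHom 1 v = v := by simp
    rw [← h1, hone]
    simp [LinearMap.sum_apply, h]
  let L : (Fin (d k) → ℂ) →ₗ[ℂ] (Fin n → ℂ) :=
    { toFun x := ρ.asAlgebraHom (e.symm (Pi.single k (vecMulVec x (Pi.single i 1)))) v
      map_add' x y := by rw [add_vecMulVec, Pi.single_add]; simp
      map_smul' c x := by rw [smul_vecMulVec, Pi.single_smul]; simp }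
  have hL (g : G) (x : Fin (d k) → ℂ) : L (blockRep e k g x) = ρ g (L x) := by
    change ρ.asAlgebraHom _ v = ρ g (ρ.asAlgebraHom _ v)
    rw [← Representation.asAlgebraHom_of ρ g, ← Module.End.mul_apply, ← map_mul]
    congr 2
    apply e.injective
    rw [map_mul, AlgEquiv.apply_symm_apply, AlgEquiv.apply_symm_apply]
    funext l
    by_cases hl : l = k
    · subst hl
      simp [blockRep_apply, blockMatrix_apply, Matrix.mul_vecMulVec]
    · simp [Pi.single_eq_of_ne hl]
  have := isIrreducible_blockRep e k (hd k)
  refine ⟨k, Quotient.sound ?_⟩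
  rcases Representation.IsIrreducible.bijective_or_eq_zero
    (L.intertwiningMap_of_isIntertwiningMap _ _ hL) with h | h
  · exact ⟨Representation.IntertwiningMap.ofBijective _ h⟩
  · refine absurd ?_ hki
    have h0 : L (Pi.single i 1) = 0 := congrArg (fun f => f (Pi.single i (1 : ℂ))) h
    simpa [L, single_eq_single_vecMulVec_single] using h0

end BlockIrreps

/-! ### Matrix products as sums over paths -/

theorem Matrix.prod_ofFn_apply {I R : Type*} [Fintype I] [DecidableEq I] [CommSemiring R] {n : ℕ}
    (A : Fin (n + 1) → Matrix I I R) (a b : I) :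
    -- Here `p` lists the interior points of a path from `a` to `b`; `cons` and `snoc` give the
    -- start and the end of each step.
    (List.ofFn A).prod a b = ∑ p : Fin n → I, ∏ i,
      A i ((Fin.cons a p : Fin (n + 1) → I) i) ((Fin.snoc p b : Fin (n + 1) → I) i) := by
  induction n generalizing a with
  | zero => simp [List.ofFn_succ, Fin.snoc]
  | succ n ih =>
    rw [List.ofFn_succ, List.prod_cons, Matrix.mul_apply,
      ← (Fin.consEquiv fun _ : Fin (n + 1) => I).sum_comp, Fintype.sum_prod_type]
    refine Finset.sum_congr rfl fun c _ => ?_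
    rw [ih, Finset.mul_sum]
    refine Finset.sum_congr rfl fun p _ => ?_
    conv_rhs => rw [Fin.prod_univ_succ]
    have hs : (Fin.snoc (Fin.consEquiv (fun _ : Fin (n + 1) => I) (c, p)) b : Fin (n + 2) → I) =
        Fin.cons c (Fin.snoc p b : Fin (n + 1) → I) := (Fin.cons_snoc_eq_snoc_cons c p b).symm
    simp only [hs, Fin.consEquiv_apply, Fin.cons_zero, Fin.cons_succ]

theorem Matrix.sum_mul_prod_ofFn_diag {I R : Type*} [Fintype I] [DecidableEq I] [CommSemiring R]
    {n : ℕ} (A : Fin (n + 1) → Matrix I I R) (D : I → R) :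
    ∑ a, D a * (List.ofFn A).prod a a =
      ∑ q : Fin (n + 1) → I, D (q 0) * ∏ i, A i (q i) (q (finRotate (n + 1) i)) := by
  rw [← (Fin.consEquiv fun _ : Fin (n + 1) => I).sum_comp, Fintype.sum_prod_type]
  refine Finset.sum_congr rfl fun a _ => ?_
  rw [Matrix.prod_ofFn_apply, Finset.mul_sum]
  refine Finset.sum_congr rfl fun p _ => ?_
  simp only [Fin.consEquiv_apply, Fin.cons_zero]
  congr 1
  refine Finset.prod_congr rfl fun i _ => ?_
  congr 1
  induction i using Fin.lastCases with
  | last => simp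
  | cast i => simp

theorem Equiv.Perm.SameCycle.eq_of_invariant {α β : Type*} [Finite α] {σ : Equiv.Perm α} {f : α → β}
    (hf : ∀ a, f (σ a) = f a) {a b : α} (h : σ.SameCycle a b) : f a = f b := by
  obtain ⟨n, rfl⟩ := h.exists_nat_pow_eq
  induction n with
  | zero => rfl
  | succ n ih => rw [pow_succ', Equiv.Perm.mul_apply, hf, ← ih ⟨n, by simp⟩]

/-! ### Rotation systems and products around vertices -/

namespace OrientedMap

variable {V E H : Type*} (M : OrientedMap V E H)

theorem opp_opp (h : H) : M.opp (M.opp h) = h := by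
  have h1 := (M.edge_eq_iff h (M.opp h)).2 (.inr rfl)
  rcases (M.edge_eq_iff (M.opp h) h).1 h1.symm with h2 | h2
  · exact absurd h2.symm (M.opp_ne h)
  · exact h2.symm

theorem edge_opp (h : H) : M.edge (M.opp h) = M.edge h :=
  ((M.edge_eq_iff h (M.opp h)).2 (.inr rfl)).symm

theorem vertex_rot (h : H) : M.vertex (M.rot h) = M.vertex h :=
  (M.vertex_eq_iff _ _).2 (Equiv.Perm.sameCycle_apply_left.2 (.refl _ _))

theorem vertex_rot_pow (n : ℕ) (h : H) : M.vertex ((M.rot ^ n) h) = M.vertex h :=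
  (M.vertex_eq_iff _ _).2 (Equiv.Perm.sameCycle_pow_left.2 (.refl _ _))

theorem degreeAt_rot (h : H) : M.degreeAt (M.rot h) = M.degreeAt h := by
  simp only [degreeAt, vertex_rot]

theorem isCycleOn_rot [Fintype H] [DecidableEq V] (h : H) :
    M.rot.IsCycleOn (Finset.univ.filter fun k => M.vertex k = M.vertex h : Finset H) := by
  refine ⟨⟨fun k hk => ?_, M.rot.injective.injOn, fun k hk => ⟨M.rot.symm k, ?_, by simp⟩⟩,
    fun k hk l hl => ?_⟩
  · simpa [vertex_rot] using hk
  · have := M.vertex_rot (M.rot.symm k)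
    simp only [Equiv.apply_symm_apply] at this
    simpa [← this] using hk
  · rw [← vertex_eq_iff]
    simp only [Finset.coe_filter, Finset.mem_univ, true_and, Set.mem_ofPred_eq] at hk hl
    rw [hk, hl]

theorem Orientation.prod_halfEdges [Fintype H] [Fintype E] {R : Type*} [CommMonoid R]
    {M : OrientedMap V E H} (o : M.Orientation) (f : H → R) :
    ∏ h, f h = ∏ e, f (o.tail e) * f (M.opp (o.tail e)) := by
  classical
  rw [← Finset.prod_fiberwise Finset.univ M.edge f]
  refine Finset.prod_congr rfl fun e _ => ?_
  rw [← Finset.prod_pair (M.opp_ne _).symm]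
  congr 1
  ext h
  have := M.edge_eq_iff (o.tail e) h
  rw [o.edge_tail] at this
  simp [← this, eq_comm]

theorem Orientation.value_tail {G : Type*} [Group G] {M : OrientedMap V E H} (o : M.Orientation) (φ : E → G) (e : E) :
    o.value φ (o.tail e) = φ e := by
  simp [value, o.edge_tail]

theorem Orientation.value_opp_tail {G : Type*} [Group G] {M : OrientedMap V E H} (o : M.Orientation) (φ : E → G) (e : E) :
    o.value φ (M.opp (o.tail e)) = (φ e)⁻¹ := by
  simp [value, o.edge_tail, M.edge_opp, M.opp_ne]

theorem Orientation.forall_halfEdge {M : OrientedMap V E H} (o : M.Orientation) {P : H → Prop} :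
    (∀ h, P h) ↔ ∀ e, P (o.tail e) ∧ P (M.opp (o.tail e)) := by
  refine ⟨fun h e => ⟨h _, h _⟩, fun h k => ?_⟩
  rcases (M.edge_eq_iff (o.tail (M.edge k)) k).1 (o.edge_tail _) with h1 | h1
  · exact h1 ▸ (h _).1
  · exact h1 ▸ (h _).2

variable [Finite H]

theorem rot_pow_degreeAt (h : H) : (M.rot ^ M.degreeAt h) h = h := by
  classical
  have := Fintype.ofFinite H
  have h1 := (M.isCycleOn_rot h).pow_card_apply (a := h) (by simp)
  rwa [degreeAt, Nat.card_eq_fintype_card, Fintype.card_subtype]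

theorem exists_equiv_rotation (h : H) :
    ∃ (n : ℕ) (ε : Fin (n + 1) ≃ {k // M.vertex k = M.vertex h}), M.degreeAt h = n + 1 ∧
      (∀ i, (ε i : H) = (M.rot ^ (i : ℕ)) h) ∧
      ∀ i, (ε (finRotate (n + 1) i) : H) = M.rot (ε i) := by
  classical
  have := Fintype.ofFinite H
  have hpos : 0 < M.degreeAt h := by
    have : Nonempty {k // M.vertex k = M.vertex h} := ⟨⟨h, rfl⟩⟩
    exact Nat.card_pos
  obtain ⟨n, hn⟩ := Nat.exists_eq_succ_of_ne_zero hpos.ne'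
  let f : Fin (n + 1) → {k // M.vertex k = M.vertex h} :=
    fun i => ⟨(M.rot ^ (i : ℕ)) h, M.vertex_rot_pow _ _⟩
  have hcard : Fintype.card {k // M.vertex k = M.vertex h} = n + 1 := by
    rw [← Nat.card_eq_fintype_card]
    exact hn
  have hf : Function.Surjective f := fun ⟨k, hk⟩ => by
    obtain ⟨i, hi, hik⟩ := (M.isCycleOn_rot h).exists_pow_eq (a := h) (b := k) (by simp)
      (by simpa using hk)
    rw [← Fintype.card_subtype, hcard] at hi
    exact ⟨⟨i, hi⟩, Subtype.ext hik⟩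
  have hb : Function.Bijective f := by
    rw [Fintype.bijective_iff_surjective_and_card]
    exact ⟨hf, by simp [hcard]⟩
  refine ⟨n, Equiv.ofBijective f hb, hn, fun i => rfl, fun i => ?_⟩
  induction i using Fin.lastCases with
  | last =>
    have := M.rot_pow_degreeAt h
    rw [hn, Nat.succ_eq_add_one, pow_succ'] at this
    simpa [f] using this.symm
  | cast i => simp [f, pow_succ']

/-- The product, in anticlockwise order, of values on the half-edges around a vertex. -/
noncomputable def rotProd {G : Type*} [Monoid G] (x : H → G) (h : H) : G :=
  ((List.range (M.degreeAt h)).map fun i => x ((M.rot ^ i) h)).prod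

/-- Both sides are the product of `degreeAt h + 1` consecutive factors, split off at either end. In
a group, changing the starting half-edge thus only conjugates the product. -/
theorem mul_rotProd_rot {G : Type*} [Monoid G] (x : H → G) (h : H) :
    x h * M.rotProd x (M.rot h) = M.rotProd x h * x h := by
  have h1 := List.prod_range_succ (fun i => x ((M.rot ^ i) h)) (M.degreeAt h)
  have h2 := List.prod_range_succ' (fun i => x ((M.rot ^ i) h)) (M.degreeAt h)
  rw [h1, M.rot_pow_degreeAt] at h2
  simpa [rotProd, degreeAt_rot, pow_succ] using h2.symm

theorem rotProd_eq_one_of_vertex_eq {G : Type*} [Group G] (x : H → G) {h k : H}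
    (hk : M.vertex h = M.vertex k) : M.rotProd x h = 1 ↔ M.rotProd x k = 1 := by
  refine iff_of_eq (((M.vertex_eq_iff h k).1 hk).eq_of_invariant
    (f := fun h => M.rotProd x h = 1) fun a => propext ?_)
  have h1 := M.mul_rotProd_rot x a
  constructor <;> intro h2 <;> simpa [h2] using h1

/-- The weighted trace of a product around a vertex as a state sum. -/
theorem sum_mul_rotProd_diag {G I R : Type*} [Monoid G] [Fintype I] [DecidableEq I]
    [CommSemiring R] (Q : G →* Matrix I I R) (D : I → R) (x : H → G) {v : V} {h : H}
    (hv : M.vertex h = v) [Fintype {k // M.vertex k = v}] [DecidableEq {k // M.vertex k = v}] :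
    ∑ a, D a * Q (M.rotProd x h) a a = ∑ p : {k // M.vertex k = v} → I, D (p ⟨h, hv⟩) *
      ∏ k : {k // M.vertex k = v}, Q (x k) (p k) (p ⟨M.rot k, (M.vertex_rot k).trans k.2⟩) := by
  subst hv
  obtain ⟨n, ε, hn, hε, hrot⟩ := M.exists_equiv_rotation h
  have hprod : Q (M.rotProd x h) = (List.ofFn fun i => Q (x (ε i))).prod := by
    rw [rotProd, map_list_prod, hn, List.map_map, List.ofFn_eq_map,
      ← List.map_coe_finRange_eq_range, List.map_map]
    congr 2
    funext i
    simp [hε]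
  have h0 : ε 0 = ⟨h, rfl⟩ := Subtype.ext (by simp [hε])
  rw [hprod, Matrix.sum_mul_prod_ofFn_diag, ← (ε.arrowCongr (Equiv.refl I)).sum_comp]
  refine Finset.sum_congr rfl fun q _ => ?_
  rw [← ε.prod_comp, ← h0]
  simp only [Equiv.arrowCongr_apply, Equiv.coe_refl, Function.comp_apply, id_eq,
    Equiv.symm_apply_apply]
  congr 1
  refine Finset.prod_congr rfl fun i _ => ?_
  have hs : ε.symm ⟨M.rot (ε i), (M.vertex_rot _).trans (ε i).2⟩ = finRotate (n + 1) i :=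
    (Equiv.symm_apply_eq _).2 (Subtype.ext (hrot i).symm)
  rw [hs]

theorem eq_of_connected {β : Type*} (hM : M.Connected) {f : H → β}
    (hopp : ∀ h, f (M.opp h) = f h) (hrot : ∀ h, f (M.rot h) = f h) (h k : H) : f h = f k := by
  have hv {a b : H} (hab : M.vertex a = M.vertex b) : f a = f b :=
    ((M.vertex_eq_iff a b).1 hab).eq_of_invariant hrot
  have hr : Relation.ReflTransGen M.underlying.Adj (M.vertex h) (M.vertex k) :=
    (SimpleGraph.reachable_iff_reflTransGen _ _).1 (hM.preconnected _ _)
  generalize hw : M.vertex k = w at hr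
  induction hr generalizing k with
  | refl => exact hv hw.symm
  | tail _ hadj ih =>
    rw [underlying, SimpleGraph.fromRel_adj] at hadj
    rcases hadj with ⟨-, ⟨l, h1, h2⟩ | ⟨l, h1, h2⟩⟩
    · rw [ih l h1, ← hopp, hv (h2.trans hw.symm)]
    · rw [ih _ h2, hopp, hv (h1.trans hw.symm)]

end OrientedMap

/-! ### The state sum and its localization on faces -/

namespace OrientedMap

variable {V E H : Type*} {M : OrientedMap V E H} {G ι : Type*} [Group G] {d : ι → ℕ}

/-- The labellings of half-edges that contribute to the state sum: those which are constant along
faces and have all labels around a vertex in the same block. -/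
def IsAdmissible (M : OrientedMap V E H) (p : H → Σ k, Fin (d k)) : Prop :=
  ∀ h, p h = p (M.rot (M.opp h)) ∧ (p h).1 = (p (M.rot h)).1

open Classical in
theorem Orientation.sum_prod_wedderburnMatrix [Fintype ι] [DecidableEq ι] [Fintype G]
    [Fintype H] [Fintype E]
    (e : MonoidAlgebra ℂ G ≃ₐ[ℂ] Π k, Matrix (Fin (d k)) (Fin (d k)) ℂ)
    (o : M.Orientation) (p : H → Σ k, Fin (d k)) :
    ∑ φ : E → G, ∏ h, wedderburnMatrix e (o.value φ h) (p h) (p (M.rot h)) =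
      if M.IsAdmissible p then ∏ a, (Nat.card G : ℂ) / d (p (o.tail a)).1 else 0 := by
  simp only [o.prod_halfEdges, o.value_tail, o.value_opp_tail]
  rw [← Fintype.piFinset_univ, ← Finset.prod_univ_sum (fun _ : E => (Finset.univ : Finset G))
    fun a g => wedderburnMatrix e g (p (o.tail a)) (p (M.rot (o.tail a))) *
      wedderburnMatrix e g⁻¹ (p (M.opp (o.tail a))) (p (M.rot (M.opp (o.tail a))))]
  simp only [sum_wedderburnMatrix_mul_inv]
  -- Admissibility at the two ends of an edge is one orthogonality condition: the block condition at
  -- the second end follows from the rest.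
  have hiff : M.IsAdmissible p ↔ ∀ a, p (o.tail a) = p (M.rot (M.opp (o.tail a))) ∧
      p (M.rot (o.tail a)) = p (M.opp (o.tail a)) ∧ (p (o.tail a)).1 = (p (M.rot (o.tail a))).1 := by
    rw [IsAdmissible, o.forall_halfEdge]
    refine forall_congr' fun a => ?_
    rw [M.opp_opp]
    constructor
    · rintro ⟨⟨h1, h2⟩, h3, -⟩
      exact ⟨h1, h3.symm, h2⟩
    · rintro ⟨h1, h2, h3⟩
      exact ⟨⟨h1, h3⟩, h2.symm, by rw [← h2, ← h1, h3]⟩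
  split_ifs with h
  · exact Finset.prod_congr rfl fun a _ => if_pos (hiff.1 h a)
  · rw [hiff] at h
    push Not at h
    obtain ⟨a, ha⟩ := h
    exact Finset.prod_eq_zero (Finset.mem_univ a) (if_neg fun h' => ha h'.1 h'.2.1 h'.2.2)

theorem IsAdmissible.fst_eq [Finite H] (hM : M.Connected) {p : H → Σ k, Fin (d k)}
    (hp : M.IsAdmissible p) (h k : H) : (p h).1 = (p k).1 :=
  M.eq_of_connected hM (f := fun h => (p h).1)
    (fun h => by rw [(hp (M.opp h)).2, (hp h).1]) (fun h => ((hp h).2).symm) h k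

/-- The labelling given by a block and a labelling of the faces. -/
def faceLabelling (M : OrientedMap V E H)
    (q : Σ k, (Quotient (Equiv.Perm.SameCycle.setoid M.faceNext) → Fin (d k))) (h : H) :
    Σ k, Fin (d k) :=
  ⟨q.1, q.2 (Quotient.mk _ (M.opp h))⟩

theorem faceLabelling_injective [Nonempty H] :
    Function.Injective (M.faceLabelling (d := d)) := by
  rintro ⟨k, q⟩ ⟨l, q'⟩ h
  obtain rfl : k = l := congrArg (fun p => (p (Classical.arbitrary H)).1) h
  congr 1
  funext f
  obtain ⟨x, rfl⟩ := Quotient.exists_rep f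
  have h1 := congrFun h (M.opp x)
  simpa [faceLabelling, M.opp_opp] using h1

/-- Passing from `h` to `M.rot (M.opp h)` is, after applying `opp`, one face-tracing step backwards;
this is why `faceLabelling` reads the face of `M.opp h`. -/
theorem isAdmissible_faceLabelling
    (q : Σ k, (Quotient (Equiv.Perm.SameCycle.setoid M.faceNext) → Fin (d k))) :
    M.IsAdmissible (M.faceLabelling q) := by
  refine fun h => ⟨?_, rfl⟩
  have h1 : (Quotient.mk (Equiv.Perm.SameCycle.setoid M.faceNext) (M.opp h)) =
      Quotient.mk _ (M.opp (M.rot (M.opp h))) := by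
    refine Quotient.sound ?_
    change M.faceNext.SameCycle _ _
    have h2 : M.faceNext (M.opp (M.rot (M.opp h))) = M.opp h := by simp [faceNext, M.opp_opp]
    conv_lhs => rw [← h2]
    exact Equiv.Perm.sameCycle_apply_left.2 (.refl _ _)
  simp [faceLabelling, h1]

theorem IsAdmissible.exists_faceLabelling [Finite H] [Nonempty H] (hM : M.Connected)
    {p : H → Σ k, Fin (d k)} (hp : M.IsAdmissible p) : ∃ q, M.faceLabelling q = p := by
  have h1 : ∃ k, ∀ h, ∃ i : Fin (d k), p h = ⟨k, i⟩ := by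
    refine ⟨(p (Classical.arbitrary H)).1, fun h => ?_⟩
    rw [hp.fst_eq hM (Classical.arbitrary H) h]
    exact ⟨_, rfl⟩
  obtain ⟨k, h1⟩ := h1
  choose i hi using h1
  refine ⟨⟨_, Quotient.lift (fun h => i (M.opp h)) fun a b hab => ?_⟩, ?_⟩
  · change M.faceNext.SameCycle a b at hab
    refine hab.eq_of_invariant (f := fun h => i (M.opp h)) fun h => ?_
    have h2 := (hp (M.opp (M.faceNext h))).1
    rw [M.opp_opp, hi, hi] at h2
    have h3 := eq_of_heq (Sigma.mk.inj h2).2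
    simpa [faceNext] using h3
  · funext h
    simp [faceLabelling, M.opp_opp, hi h]

/-- The state sum of a connected map localizes at labellings of the faces. -/
theorem sum_isAdmissible [Fintype ι] [DecidableEq H] [Fintype V] [Fintype E] [Fintype H]
    [Nonempty H] (hM : M.Connected)
    (o : M.Orientation) (s : V → H) (c : ℂ) [DecidablePred (M.IsAdmissible (d := d))] :
    ∑ p : H → Σ k, Fin (d k), (∏ v, (d (p (s v)).1 : ℂ)) *
      (if M.IsAdmissible p then ∏ a, c / d (p (o.tail a)).1 else 0) =
    ∑ k, (d k : ℂ) ^ Nat.card V * (c / d k) ^ Nat.card E *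
      (d k : ℂ) ^ Nat.card (Quotient (Equiv.Perm.SameCycle.setoid M.faceNext)) := by
  classical
  have := Fintype.ofFinite (Quotient (Equiv.Perm.SameCycle.setoid M.faceNext))
  rw [← Fintype.sum_of_injective (M.faceLabelling (d := d)) faceLabelling_injective
    (fun q => (d q.1 : ℂ) ^ Nat.card V * (c / d q.1) ^ Nat.card E)]
  · rw [Fintype.sum_sigma]
    refine Finset.sum_congr rfl fun k _ => ?_
    simp [mul_comm]
  · intro p hp
    rw [if_neg fun h => hp (h.exists_faceLabelling hM), mul_zero]
  · intro q
    simp [isAdmissible_faceLabelling, faceLabelling, div_pow]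

theorem Orientation.isLocalFlow_iff [Finite H] (o : M.Orientation) {s : V → H}
    (hs : ∀ v, M.vertex (s v) = v) (φ : E → G) :
    o.IsLocalFlow φ ↔ ∀ v, M.rotProd (o.value φ) (s v) = 1 :=
  ⟨fun h _ => h _, fun h k => (M.rotProd_eq_one_of_vertex_eq _ (hs (M.vertex k))).1 (h _)⟩

/-- The half-edges are partitioned by their vertices, so independent labellings around the vertices
are the same as one labelling of `H`. -/
theorem prod_sum_mul_rotProd_diag [Fintype V] [Fintype H] [DecidableEq H] {s : V → H}
    (hs : ∀ v, M.vertex (s v) = v) {I : Type*} [Fintype I] [DecidableEq I] (Q : G →* Matrix I I ℂ)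
    (D : I → ℂ) (x : H → G) :
    ∏ v, ∑ a, D a * Q (M.rotProd x (s v)) a a =
      ∑ p : H → I, (∏ v, D (p (s v))) * ∏ h, Q (x h) (p h) (p (M.rot h)) := by
  classical
  simp only [fun v => M.sum_mul_rotProd_diag Q D x (hs v)]
  rw [Finset.prod_univ_sum, Fintype.piFinset_univ]
  let ε : (H → I) ≃ (∀ v, {k // M.vertex k = v} → I) :=
    ((Equiv.sigmaFiberEquiv M.vertex).arrowCongr (Equiv.refl I)).symm.trans
      (Equiv.piCurry fun _ _ => I)
  have hε (p : H → I) (v : V) (k : {k // M.vertex k = v}) : ε p v k = p k := rfl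
  rw [← ε.sum_comp]
  refine Finset.sum_congr rfl fun p _ => ?_
  simp only [hε]
  rw [Finset.prod_mul_distrib]
  congr 1
  rw [← (Equiv.sigmaFiberEquiv M.vertex).prod_comp, Fintype.prod_sigma]
  rfl

theorem Orientation.numLocalFlows_mul_pow [Fintype ι] [DecidableEq ι] [Finite G]
    [Finite V] [Finite E] [Finite H] (e : MonoidAlgebra ℂ G ≃ₐ[ℂ] Π k, Matrix (Fin (d k)) (Fin (d k)) ℂ)
    (o : M.Orientation)
    (hM : M.Connected) (hsurj : Function.Surjective M.vertex) :
    (o.numLocalFlows G : ℂ) * (Nat.card G : ℂ) ^ Nat.card V =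
      ∑ k, (d k : ℂ) ^ Nat.card V * ((Nat.card G : ℂ) / d k) ^ Nat.card E *
        (d k : ℂ) ^ Nat.card (Quotient (Equiv.Perm.SameCycle.setoid M.faceNext)) := by
  classical
  have := Fintype.ofFinite V
  have := Fintype.ofFinite E
  have := Fintype.ofFinite H
  have := Fintype.ofFinite G
  obtain ⟨s, hs⟩ := hsurj.hasRightInverse
  have := hM.nonempty
  have : Nonempty H := ⟨s (Classical.arbitrary V)⟩
  rw [← sum_isAdmissible hM o s]
  simp only [← o.sum_prod_wedderburnMatrix e, Finset.mul_sum]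
  -- Orthogonality was the sum over `φ` first; summing over labels first recovers the regular
  -- character at each vertex.
  rw [Finset.sum_comm]
  simp only [← prod_sum_mul_rotProd_diag hs (wedderburnMatrix e) (fun a => (d a.1 : ℂ)),
    sum_dim_mul_wedderburnMatrix]
  have (φ : E → G) : (∏ v, if M.rotProd (o.value φ) (s v) = 1 then (Nat.card G : ℂ) else 0) =
      if o.IsLocalFlow φ then (Nat.card G : ℂ) ^ Nat.card V else 0 := by
    rw [o.isLocalFlow_iff hs]
    split_ifs with h
    · simp [h]
    · push Not at h
      obtain ⟨v, hv⟩ := h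
      exact Finset.prod_eq_zero (Finset.mem_univ v) (if_neg hv)
  simp only [this]
  rw [← Finset.sum_filter, Finset.sum_const, nsmul_eq_mul, numLocalFlows,
    Nat.card_eq_fintype_card (α := {φ : E → G // o.IsLocalFlow φ}), Fintype.card_subtype]

theorem natCard_face_of_surjective [Finite H] (hsurj : Function.Surjective M.vertex) :
    Nat.card M.Face = Nat.card (Quotient (Equiv.Perm.SameCycle.setoid M.faceNext)) := by
  have : IsEmpty {v : V // ∀ h, M.vertex h ≠ v} := ⟨fun ⟨v, hv⟩ => (hsurj v).elim hv⟩
  exact Nat.card_congr (Equiv.sumEmpty _ _)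

theorem Connected.eq_of_isolated (hM : M.Connected) {v : V} (hv : ∀ h, M.vertex h ≠ v) (w : V) :
    w = v := by
  have hr : Relation.ReflTransGen M.underlying.Adj w v :=
    (SimpleGraph.reachable_iff_reflTransGen _ _).1 (hM.preconnected _ _)
  rcases hr.cases_tail with h | ⟨u, -, hadj⟩
  · exact h.symm
  · rw [underlying, SimpleGraph.fromRel_adj] at hadj
    rcases hadj with ⟨-, ⟨l, -, h2⟩ | ⟨l, h1, -⟩⟩
    · exact absurd h2 (hv _)
    · exact absurd h1 (hv _)

theorem Orientation.numLocalFlows_eq_sum [Fintype ι] [DecidableEq ι] [Finite G]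
    [Finite V] [Finite E] [Finite H] (e : MonoidAlgebra ℂ G ≃ₐ[ℂ] Π k, Matrix (Fin (d k)) (Fin (d k)) ℂ)
    (o : M.Orientation)
    (hM : M.Connected) (hd : ∀ k, d k ≠ 0) :
    (o.numLocalFlows G : ℂ) = (Nat.card G : ℂ) ^ ((Nat.card E : ℤ) - (Nat.card V : ℤ)) *
      ∑ k, (d k : ℂ) ^ M.eulerChar := by
  classical
  have hG : (Nat.card G : ℂ) ≠ 0 := by exact_mod_cast Nat.card_pos.ne'
  have hd' (k : ι) : (d k : ℂ) ≠ 0 := by exact_mod_cast hd k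
  by_cases hsurj : Function.Surjective M.vertex
  · refine mul_right_cancel₀ (pow_ne_zero (Nat.card V) hG) ?_
    rw [o.numLocalFlows_mul_pow e hM hsurj, zpow_sub₀ hG, zpow_natCast, zpow_natCast,
      mul_right_comm, div_mul_cancel₀ _ (pow_ne_zero _ hG), Finset.mul_sum]
    refine Finset.sum_congr rfl fun k _ => ?_
    rw [eulerChar, natCard_face_of_surjective hsurj, zpow_add₀ (hd' k), zpow_sub₀ (hd' k)]
    simp only [zpow_natCast, div_pow]
    ring
  · rw [Function.Surjective] at hsurj
    push Not at hsurj
    obtain ⟨v, hv⟩ := hsurj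
    -- An isolated vertex is the whole map: a sphere with `χ = 2` and only the empty flow.
    have hw := hM.eq_of_isolated hv
    have : Unique V := ⟨⟨v⟩, hw⟩
    have : IsEmpty H := ⟨fun h => hv h (hw _)⟩
    have : IsEmpty E := ⟨fun a => isEmptyElim (o.tail a)⟩
    have : Unique {v : V // ∀ h, M.vertex h ≠ v} := ⟨⟨⟨v, hv⟩⟩, fun x => Subtype.ext (hw _)⟩
    have : IsEmpty (Quotient (Equiv.Perm.SameCycle.setoid M.faceNext)) :=
      ⟨fun q => q.exists_rep.elim fun h _ => isEmptyElim h⟩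
    have hF : Nat.card M.Face = 1 :=
      (Nat.card_congr (Equiv.emptySum _ _)).trans Nat.card_unique
    have : Unique {φ : E → G // o.IsLocalFlow φ} :=
      ⟨⟨⟨isEmptyElim, fun h => isEmptyElim h⟩⟩, fun x => Subtype.ext (Subsingleton.elim _ _)⟩
    have hs := sum_mul_trace_blockMatrix e (1 : G)
    simp only [map_one, Matrix.trace_one, Fintype.card_fin, if_true] at hs
    have hχ : M.eulerChar = 2 := by simp [eulerChar, hF]
    have hsq : ∑ k, (d k : ℂ) ^ (2 : ℤ) = Nat.card G := by
      rw [← hs]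
      exact Finset.sum_congr rfl fun k _ => by rw [zpow_ofNat, sq]
    rw [hχ, hsq, numLocalFlows, Nat.card_unique]
    simp [hG]

end OrientedMap

/-! ### Passage to isomorphism classes and to `ℚ` -/

theorem mainTheorem2 {V E H : Type*} [Finite V] [Finite E] [Finite H]
    (M : OrientedMap V E H) (hM : M.Connected) (o : M.Orientation)
    (G : Type*) [Group G] [Finite G] :
    Finite (IrrepClass G) ∧
      (o.numLocalFlows G : ℚ) =
        (Nat.card G : ℚ) ^ ((Nat.card E : ℤ) - (Nat.card V : ℤ)) *
          ∑ᶠ ℓ : IrrepClass G, (ℓ.dim : ℚ) ^ M.eulerChar := by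
  obtain ⟨n, d, hd, ⟨e⟩⟩ :=
    IsSemisimpleRing.exists_algEquiv_pi_matrix_of_isAlgClosed ℂ (MonoidAlgebra ℂ G)
  have hd (k : Fin n) : d k ≠ 0 := (hd k).ne
  have hb : Function.Bijective (blockClass e hd) :=
    ⟨blockClass_injective e hd, blockClass_surjective e hd⟩
  refine ⟨Finite.of_surjective _ hb.2, ?_⟩
  rw [← finsum_eq_of_bijective (f := fun k : Fin n => (d k : ℚ) ^ M.eulerChar) _ hb fun k => rfl,
    finsum_eq_sum_of_fintype]
  have h := o.numLocalFlows_eq_sum e hM hd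
  apply Rat.cast_injective (α := ℂ)
  push_cast
  exact h
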